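/- Let $\mathcal F$ be an ordinary differential field of characteristic $0$ with derivation $\delta$, let $\mathcal E$ be a universal differential extension field of $\mathcal F$ (that is, for every finitely generated differential extension field $K\subseteq\mathcal E$ of $\mathcal F$, every finitely generated differential extension field of $K$ embeds into $\mathcal E$ over $K$), and let $\mathcal F\{x,y\}=\mathcal F[x^{(k)},y^{(k)}:k\in\mathbb N]$ be the ring of differential polynomials in two differential indeterminates. For $\Sigma\subset\mathcal F\{x,y\}$ let $[\Sigma]$ be the differential ideal generated by $\Sigma$, and let $\operatorname{ord}(f)$ be the largest $k$ such that $x^{(k)}$ or $y^{(k)}$ appears in $f$. Fix any ranking on the derivatives $x^{(k)},y^{(k)}$. For $A\in\mathcal F\{x,y\}\setminus\mathcal F$ irreducible, let $\operatorname{sat}(A)=\{f\in\mathcal F\{x,y\}:(S_AI_A)^m f\in[A]\text{ for some }m\in\mathbb N\}$, where $S_A$ and $I_A$ are the separant and the initial of $A$, and let $\mathcal C=\mathbb V(\operatorname{sat}(A))\subseteq\mathbb A^2(\mathcal E)$ be the differential curve defined by $A$, denoted $(\mathcal C,A)$. We say that $(\mathcal C,A)$ (or $A$) is unirational if there are $u\in\mathcal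 E$ differentially transcendental over $\mathcal F$ and $P_1,Q_1,P_2,Q_2\in\mathcal F\{u\}$ with $Q_i\neq0$ and $\gcd(P_i,Q_i)=1$ for $i=1,2$ such that $\big(P_1(u)/Q_1(u),P_2(u)/Q_2(u)\big)$ is a generic point of $\mathcal C$, i.e. $\operatorname{sat}(A)$ is exactly the set of all $f\in\mathcal F\{x,y\}$ that vanish at this point. Let $A,B\in\mathcal F\{x,y\}\setminus\mathcal F$ be linear differential polynomials (of total degree at most $1$ in the $x^{(k)},y^{(k)}$, a constant term from $\mathcal F$ being allowed). 1. If $A\in[B]$ and $\operatorname{ord}(A)>\operatorname{ord}(B)$, then $(\mathcal C,A)$ is not unirational. 2. If $A$ is unirational and $[A]\subseteq[B]$, then $[A]=[B]$. -/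

import Mathlib

open scoped Differential

/-! ### Differential polynomials -/

/-- The differential polynomial ring `F{y_j : j ∈ σ}` as a commutative ring: the polynomial ring
in the variables `(j, k)`, where `(j, k)` stands for the derivative `y_j^{(k)}`. -/
abbrev DiffPoly (F : Type*) (σ : Type*) [CommRing F] : Type _ := MvPolynomial (σ × ℕ) F

namespace DiffPoly

/-- Apply the derivation of `F` to every coefficient, as an additive map. -/
noncomputable def mapCoeffAddHom (F : Type*) (ι : Type*) [CommRing F] [Differential F] :
    MvPolynomial ι F →+ MvPolynomial ι F :=
  (AddMonoidAlgebra.coeffAddEquiv (R := F) (M := ι →₀ ℕ)).symm.toAddMonoidHom.comp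
    ((Finsupp.mapRange.addMonoidHom
      (Differential.deriv : Derivation ℤ F F).toLinearMap.toAddMonoidHom).comp
      (AddMonoidAlgebra.coeffAddEquiv (R := F) (M := ι →₀ ℕ)).toAddMonoidHom)

theorem coeff_mapCoeffAddHom {F : Type*} {ι : Type*} [CommRing F] [Differential F]
    (p : MvPolynomial ι F) (s : ι →₀ ℕ) :
    (mapCoeffAddHom F ι p).coeff s = (p.coeff s)′ := rfl

theorem mapCoeffAddHom_monomial {F : Type*} {ι : Type*} [CommRing F] [Differential F]
    (s : ι →₀ ℕ) (a : F) :
    mapCoeffAddHom F ι (MvPolynomial.monomial s a) = MvPolynomial.monomial s a′ := by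
  classical
  ext t
  rw [coeff_mapCoeffAddHom, MvPolynomial.coeff_monomial, MvPolynomial.coeff_monomial]
  split_ifs <;> simp

/-- Apply the derivation of `F` to every coefficient, as a derivation. -/
noncomputable def mapCoeffDeriv (F : Type*) (ι : Type*) [CommRing F] [Differential F] :
    Derivation ℤ (MvPolynomial ι F) (MvPolynomial ι F) :=
  Derivation.mk' (mapCoeffAddHom F ι).toIntLinearMap (by
    intro p q
    simp only [AddMonoidHom.coe_toIntLinearMap, smul_eq_mul]
    induction p using MvPolynomial.induction_on' with
    | add p₁ p₂ h₁ h₂ => simp only [add_mul, map_add, h₁, h₂, mul_add]; ring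
    | monomial s a =>
      induction q using MvPolynomial.induction_on' with
      | add q₁ q₂ h₁ h₂ => simp only [mul_add, map_add, h₁, h₂, add_mul]; ring
      | monomial t b =>
        simp only [MvPolynomial.monomial_mul, mapCoeffAddHom_monomial, Derivation.leibniz,
          smul_eq_mul, map_add]
        rw [add_comm t s, mul_comm b])

/-- The derivation `δ` of `F{y_j : j ∈ σ}`: it extends the derivation of `F` and sends
`y_j^{(k)}` to `y_j^{(k+1)}`. -/
noncomputable instance instDifferential (F : Type*) (σ : Type*) [CommRing F] [Differential F] :
    Differential (DiffPoly F σ) where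
  deriv := mapCoeffDeriv F (σ × ℕ) +
    (MvPolynomial.mkDerivation F
      fun v : σ × ℕ => (MvPolynomial.X (v.1, v.2 + 1) : DiffPoly F σ)).restrictScalars ℤ

theorem deriv_C {F : Type*} {σ : Type*} [CommRing F] [Differential F] (a : F) :
    (MvPolynomial.C a : DiffPoly F σ)′ = MvPolynomial.C a′ := by
  change mapCoeffAddHom F (σ × ℕ) (MvPolynomial.C a) + MvPolynomial.mkDerivation F _ _ = _
  rw [MvPolynomial.derivation_C, add_zero]
  exact mapCoeffAddHom_monomial 0 a

theorem deriv_X {F : Type*} {σ : Type*} [CommRing F] [Differential F] (j : σ) (k : ℕ) :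
    (MvPolynomial.X (j, k) : DiffPoly F σ)′ = MvPolynomial.X (j, k + 1) := by
  change mapCoeffAddHom F (σ × ℕ) (MvPolynomial.X (j, k)) + MvPolynomial.mkDerivation F _ _ = _
  rw [MvPolynomial.mkDerivation_X, MvPolynomial.X, mapCoeffAddHom_monomial]
  simp

instance instDifferentialAlgebra (F : Type*) (σ : Type*) [CommRing F] [Differential F] :
    DifferentialAlgebra F (DiffPoly F σ) := ⟨deriv_C⟩

/-- `ord_{y_j} f`: the largest `k` such that `y_j^{(k)}` appears in `f`, and `⊥` (that is, `-∞`)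
if none appears. -/
noncomputable def ordAt {F : Type*} {σ : Type*} [CommRing F] (j : σ) (f : DiffPoly F σ) :
    WithBot ℕ :=
  open scoped Classical in (f.vars.filter fun v => v.1 = j).sup fun v => (v.2 : WithBot ℕ)

/-- `ord f = max_j ord_{y_j} f`. -/
noncomputable def ord {F : Type*} {σ : Type*} [Fintype σ] [CommRing F] (f : DiffPoly F σ) :
    WithBot ℕ :=
  Finset.univ.sup fun j => ordAt j f

/-- Linear differential polynomials: total degree at most one in all the `y_j^{(k)}` (a constant
term is allowed). -/
def IsLinear {F : Type*} {σ : Type*} [CommRing F] (f : DiffPoly F σ) : Prop :=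
  f.totalDegree ≤ 1

/-- The value `f(η)` of a differential polynomial at a point `η`: each `y_j^{(k)}` is replaced by
`δ^k(η_j)`. -/
noncomputable def diffEval {F : Type*} {σ : Type*} {E : Type*} [CommRing F] [CommRing E]
    [Differential E] [Algebra F E] (η : σ → E) : DiffPoly F σ →ₐ[F] E :=
  MvPolynomial.aeval fun v : σ × ℕ => (Differential.deriv : Derivation ℤ E E)^[v.2] (η v.1)

end DiffPoly

/-! ### Differential ideals -/

/-- A differential ideal is an ideal closed under the derivation. -/
def IsDiffIdeal {R : Type*} [CommRing R] [Differential R] (I : Ideal R) : Prop :=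
  ∀ f ∈ I, f′ ∈ I

/-- The differential ideal `[Σ]` generated by a set. -/
def diffSpan {R : Type*} [CommRing R] [Differential R] (S : Set R) : Ideal R :=
  sInf {I : Ideal R | IsDiffIdeal I ∧ S ⊆ I}

/-! ### Rankings and saturation ideals -/

/-- A ranking: a strict total order on the derivatives `y_j^{(k)}` with `u < δu`, and
`u < v → δu < δv`. -/
structure Ranking (σ : Type*) where
  lt : σ × ℕ → σ × ℕ → Prop
  isStrictTotalOrder : IsStrictTotalOrder (σ × ℕ) lt
  lt_deriv : ∀ u : σ × ℕ, lt u (u.1, u.2 + 1)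
  deriv_lt_deriv : ∀ u v : σ × ℕ, lt u v → lt (u.1, u.2 + 1) (v.1, v.2 + 1)

namespace DiffPoly

/-- `v` is the leader of `f`: the highest ranked derivative appearing in `f`. -/
def IsLeader {F : Type*} {σ : Type*} [CommRing F] (R : Ranking σ) (f : DiffPoly F σ)
    (v : σ × ℕ) : Prop :=
  v ∈ f.vars ∧ ∀ w ∈ f.vars, w ≠ v → R.lt w v

/-- The leading coefficient of `f`, viewed as a univariate polynomial in the variable `v`. For `v`
the leader of `f` this is the initial of `f`. -/
noncomputable def initial {F : Type*} {σ : Type*} [CommRing F] (f : DiffPoly F σ)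
    (v : σ × ℕ) : DiffPoly F σ :=
  ∑ s ∈ f.support with s v = f.degreeOf v, MvPolynomial.monomial (s.erase v) (f.coeff s)

/-- The partial derivative of `f` with respect to `v`. For `v` the leader of `f` this is the
separant of `f`. -/
noncomputable def separant {F : Type*} {σ : Type*} [CommRing F] (f : DiffPoly F σ)
    (v : σ × ℕ) : DiffPoly F σ :=
  MvPolynomial.pderiv v f

/-- The saturation ideal `sat(A) = [A] : H_A^∞` with respect to a ranking, where `H_A` is the
product of the separant and the initial of `A`. For `A` irreducible it is the general component
of `A`. -/
def sat {F : Type*} {σ : Type*} [CommRing F] [Differential F] (R : Ranking σ)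
    (A : DiffPoly F σ) : Set (DiffPoly F σ) :=
  {f | ∃ v, IsLeader R A v ∧ ∃ m : ℕ, (separant A v * initial A v) ^ m * f ∈ diffSpan {A}}

end DiffPoly

/-! ### Differential field extensions -/

/-- `Θ(S)`: all derivatives (of order `≥ 0`) of the elements of `S`. -/
def derivSet {E : Type*} [CommRing E] [Differential E] (S : Set E) : Set E :=
  {b | ∃ a ∈ S, ∃ k : ℕ, b = (Differential.deriv : Derivation ℤ E E)^[k] a}

/-- `F⟨S⟩ = F(Θ(S))`, the differential subfield generated by `S` over `F`. -/
def diffAdjoin (F : Type*) {E : Type*} [Field F] [Field E] [Differential E] [Algebra F E]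
    (S : Set E) : IntermediateField F E :=
  IntermediateField.adjoin F (derivSet S)

theorem deriv_mem_diffAdjoin {F : Type*} {E : Type*} [Field F] [Differential F] [Field E]
    [Differential E] [Algebra F E] [DifferentialAlgebra F E] (S : Set E) {a : E}
    (ha : a ∈ diffAdjoin F S) : a′ ∈ diffAdjoin F S := by
  unfold diffAdjoin at ha ⊢
  induction ha using IntermediateField.adjoin_induction with
  | mem x hx =>
    obtain ⟨a, ha, k, rfl⟩ := hx
    refine IntermediateField.subset_adjoin _ _ ⟨a, ha, k + 1, ?_⟩
    rw [Function.iterate_succ_apply']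
  | algebraMap x =>
    rw [deriv_algebraMap]
    exact IntermediateField.algebraMap_mem _ _
  | add x y _ _ hx hy => rw [map_add]; exact add_mem hx hy
  | inv x hx' hx =>
    rw [Derivation.leibniz_inv]
    exact mul_mem (neg_mem (pow_mem (inv_mem hx') 2)) hx
  | mul x y hx' hy' hx hy =>
    rw [Derivation.leibniz]
    exact add_mem (mul_mem hx' hy) (mul_mem hy' hx)

/-- The derivation of `F⟨S⟩` is the restriction of that of the ambient field. -/
instance diffAdjoin.instDifferential {F : Type*} {E : Type*} [Field F] [Differential F] [Field E]
    [Differential E] [Algebra F E] [DifferentialAlgebra F E] (S : Set E) :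
    Differential (diffAdjoin F S) where
  deriv := Derivation.mk'
    ({ toFun := fun a => ⟨(a : E)′, deriv_mem_diffAdjoin S a.2⟩
       map_zero' := by ext; simp
       map_add' := fun a b => by ext; simp } :
      diffAdjoin F S →+ diffAdjoin F S).toIntLinearMap
    (fun a b => by ext; simp)

/-- `E` is a universal differential extension field of `F`: for all finitely generated
differential extension fields `K = F⟨s⟩` of `F` in `E`, every finitely generated differential
extension field `G = K⟨t⟩` of `K` (not necessarily inside `E`) embeds into `E` over `K`. -/
def IsUniversalDiffExt.{u, v} (F : Type u) (E : Type v) [Field F] [Differential F] [Field E]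
    [Differential E] [Algebra F E] [DifferentialAlgebra F E] : Prop :=
  ∀ (s : Finset E) (G : Type v) [Field G] [Differential G] [Algebra (diffAdjoin F (s : Set E)) G]
    [DifferentialAlgebra (diffAdjoin F (s : Set E)) G],
    (∃ t : Finset G, diffAdjoin (diffAdjoin F (s : Set E)) (t : Set G) = ⊤) →
    ∃ φ : G →ₐ[diffAdjoin F (s : Set E)] E, ∀ g : G, φ g′ = (φ g)′

/-- `u` is differentially transcendental over `F`: the family `u, u', u'', …` is algebraically
independent over `F`. -/
def DiffTranscendental (F : Type*) {E : Type*} [Field F] [Field E] [Differential E] [Algebra F E]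
    (u : E) : Prop :=
  AlgebraicIndependent F fun k : ℕ => (Differential.deriv : Derivation ℤ E E)^[k] u

/-! ### Unirational differential curves -/

/-- `η` is a generic point of the differential ideal `P` over `F`: a differential polynomial over
`F` vanishes at `η` exactly when it belongs to `P`. -/
def IsDiffGenericPoint {F : Type*} {E : Type*} {σ : Type*} [CommRing F] [CommRing E] [Differential E]
    [Algebra F E] (η : σ → E) (P : Set (DiffPoly F σ)) : Prop :=
  {f : DiffPoly F σ | DiffPoly.diffEval η f = 0} = P

/-- The plane differential curve `(𝒞, A)`, that is, `𝒞 = 𝕍(sat(A)) ⊆ 𝔸²(E)`, is unirational: it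
has a generic point `(P₁(u)/Q₁(u), P₂(u)/Q₂(u))` with `u ∈ E` differentially transcendental over
`F` and with coprime `Pᵢ, Qᵢ ∈ F{u}` (`Qᵢ ≠ 0`). -/
def IsUnirational {F : Type*} (E : Type*) [Field F] [Differential F] [Field E] [Differential E]
    [Algebra F E] (R : Ranking (Fin 2)) (A : DiffPoly F (Fin 2)) : Prop :=
  ∃ (u : E) (P Q : Fin 2 → DiffPoly F Unit),
    DiffTranscendental F u ∧
    (∀ i, Q i ≠ 0 ∧ IsRelPrime (P i) (Q i)) ∧
    IsDiffGenericPoint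
      (fun i => DiffPoly.diffEval (fun _ => u) (P i) / DiffPoly.diffEval (fun _ => u) (Q i))
      (DiffPoly.sat R A)

/-!
If `A` and `B` are linear and `A ∈ [B]`, then `A = L(B)` for a homogeneous linear differential
operator `L` over `F`, and `ord A` exceeds `ord B` by the order of `L`. At a generic point `η` of
`sat(A)` this gives `L(B(η)) = 0`. Now suppose that `η` lies in a purely differentially
transcendental field `F⟨s⟩`. If `w ∈ F⟨s⟩` depends on the derivatives of some `a ∈ s`, the highest
of them being `a^{(N)}`, and `L` has order `M` and leading coefficient `c`, then
`∂L(w)/∂a^{(N+M)} = c ∂w/∂a^{(N)} ≠ 0`. Hence the solutions of `L(w) = 0` in `F⟨s⟩` lie in `F`. In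
particular `b = B(η) ∈ F`, that is, `B - b ∈ sat(A) = [A]`. As before this gives `ord B ≥ ord A`,
so `L` has order zero and `[A] = [B]`.
-/

section DerivationExtension

/-- The extension of a derivation of `A` to a formally étale `A`-algebra `B`, for instance to a
localization of `A`. -/
noncomputable def extendDerivation {R A M : Type*} (B : Type*) [CommRing R] [CommRing A]
    [CommRing B] [AddCommGroup M] [Algebra R A] [Algebra R B] [Algebra A B] [IsScalarTower R A B]
    [Module R M] [Module A M] [Module B M] [IsScalarTower R A M] [IsScalarTower R B M]
    [IsScalarTower A B M] [Algebra.FormallyEtale A B] (d : Derivation R A M) : Derivation R B M :=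
  (d.liftKaehlerDifferential.liftBaseChange B ∘ₗ
    (KaehlerDifferential.tensorKaehlerEquivOfFormallyEtale R A B).symm.toLinearMap).compDer
    (KaehlerDifferential.D R B)

theorem extendDerivation_algebraMap {R A B M : Type*} [CommRing R] [CommRing A]
    [CommRing B] [AddCommGroup M] [Algebra R A] [Algebra R B] [Algebra A B] [IsScalarTower R A B]
    [Module R M] [Module A M] [Module B M] [IsScalarTower R A M] [IsScalarTower R B M]
    [IsScalarTower A B M] [Algebra.FormallyEtale A B] (d : Derivation R A M) (a : A) :
    extendDerivation B d (algebraMap A B a) = d a := by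
  simp [extendDerivation,
    KaehlerDifferential.tensorKaehlerEquivOfFormallyEtale_symm_D_algebraMap]

theorem derivation_ext_of_isFractionRing {R A K M : Type*} [CommRing R] [CommRing A] [Field K]
    [Algebra R K] [Algebra A K] [IsFractionRing A K] [AddCommGroup M] [Module R M] [Module K M]
    {d₁ d₂ : Derivation R K M} (h : ∀ a, d₁ (algebraMap A K a) = d₂ (algebraMap A K a)) :
    d₁ = d₂ := by
  ext w
  obtain ⟨a, b, -, rfl⟩ := IsFractionRing.div_surjective (A := A) w
  rw [Derivation.leibniz_div, Derivation.leibniz_div, h, h]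

end DerivationExtension

namespace DiffPoly

open MvPolynomial

section PartialDerivatives

theorem pderiv_eq_zero_iff_notMem_vars {R ι : Type*} [CommRing R] [IsDomain R] [CharZero R]
    {f : MvPolynomial ι R} {i : ι} : pderiv i f = 0 ↔ i ∉ f.vars := by
  classical
  refine ⟨fun h hi => ?_, pderiv_eq_zero_of_notMem_vars⟩
  obtain ⟨s, hs, his⟩ := (mem_vars_iff_mem_support i).1 hi
  have hcoeff := coeff_pderiv (i := i) f (s - Finsupp.single i 1)
  rw [tsub_add_cancel_of_le
    (by simpa [Nat.one_le_iff_ne_zero] using his), h, coeff_zero] at hcoeff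
  exact mul_ne_zero (mem_support_iff.1 hs) (Nat.cast_add_one_ne_zero _) hcoeff.symm

theorem degreeOf_pderiv_lt {R ι : Type*} [CommSemiring R] {f : MvPolynomial ι R} {i : ι}
    (hi : i ∈ f.vars) : degreeOf i (pderiv i f) < degreeOf i f := by
  rw [degreeOf_lt_iff (Nat.pos_of_ne_zero (mem_vars_iff_degreeOf_ne_zero.1 hi))]
  intro s hs
  rw [mem_support_iff, coeff_pderiv] at hs
  have hle := monomial_le_degreeOf i (mem_support_iff.2 (left_ne_zero_of_mul hs))
  simp only [Finsupp.add_apply, Finsupp.single_eq_same] at hle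
  exact hle

theorem pderiv_eq_zero_of_dvd_pderiv {R ι : Type*} [CommRing R] [IsDomain R]
    {f : MvPolynomial ι R} {i : ι} (h : f ∣ pderiv i f) : pderiv i f = 0 := by
  obtain ⟨g, hg⟩ := h
  by_contra hne
  have hlt := degreeOf_pderiv_lt (not_imp_comm.1 pderiv_eq_zero_of_notMem_vars hne)
  rw [hg] at hne
  rw [hg, degreeOf_mul_eq (left_ne_zero_of_mul hne) (right_ne_zero_of_mul hne)] at hlt
  omega

theorem pderiv_deriv_succ {R σ : Type*} [CommRing R] [Differential R] (j : σ) (k : ℕ)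
    (f : DiffPoly R σ) : pderiv (j, k + 1) f′ = (pderiv (j, k + 1) f)′ + pderiv (j, k) f := by
  classical
  induction f using MvPolynomial.induction_on with
  | C a => simp [deriv_C]
  | add p q hp hq => simp only [map_add, hp, hq]; ring
  | mul_X p v hp =>
    obtain ⟨i, l⟩ := v
    have hconst : (pderiv (j, k + 1) (X (i, l) : DiffPoly R σ))′ = 0 := by
      rw [pderiv_X, Pi.single_apply]; split_ifs <;> simp
    have hshift : (pderiv (j, k + 1) (X (i, l + 1)) : DiffPoly R σ) = pderiv (j, k) (X (i, l)) := by
      simp [pderiv_X, Pi.single_apply]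
    simp only [Derivation.leibniz, deriv_X, smul_eq_mul, map_add, hp, hconst, hshift]
    ring

end PartialDerivatives

section LinearDiffOp

/-- The value `∑_{k ≤ M} c_k δ^k(x)` at `x` of a homogeneous linear differential operator of order
at most `M` with coefficients `c_k` in `F`. -/
noncomputable def linearDiffOp {F K : Type*} [CommRing F] [CommRing K] [Differential K]
    [Algebra F K] (c : ℕ → F) (M : ℕ) (x : K) : K :=
  ∑ k ∈ Finset.range (M + 1), c k • (Differential.deriv : Derivation ℤ K K)^[k] x

variable {F K : Type*} [CommRing F] [CommRing K] [Differential K] [Algebra F K]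
  {D : ℕ → Derivation F K K} {x : K} {N : ℕ}

theorem derivation_iterate_deriv_eq_zero (hD : ∀ k y, D (k + 1) y′ = (D (k + 1) y)′ + D k y)
    (hx : ∀ k, N < k → D k x = 0) (m : ℕ) {k : ℕ} (hk : N + m < k) :
    D k ((Differential.deriv : Derivation ℤ K K)^[m] x) = 0 := by
  induction m generalizing k with
  | zero => exact hx k hk
  | succ m ih =>
    obtain _ | k := k
    · omega
    · rw [Function.iterate_succ_apply', hD, ih (by omega), ih (by omega), map_zero, add_zero]

theorem derivation_iterate_deriv (hD : ∀ k y, D (k + 1) y′ = (D (k + 1) y)′ + D k y)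
    (hx : ∀ k, N < k → D k x = 0) (m : ℕ) :
    D (N + m) ((Differential.deriv : Derivation ℤ K K)^[m] x) = D N x := by
  induction m with
  | zero => rfl
  | succ m ih =>
    rw [Function.iterate_succ_apply', ← add_assoc, hD, ih,
      derivation_iterate_deriv_eq_zero hD hx m (Nat.lt_succ_self _), map_zero, zero_add]

theorem derivation_linearDiffOp_eq_zero (hD : ∀ k y, D (k + 1) y′ = (D (k + 1) y)′ + D k y)
    (hx : ∀ k, N < k → D k x = 0) (c : ℕ → F) (M : ℕ) {k : ℕ} (hk : N + M < k) :
    D k (linearDiffOp c M x) = 0 := by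
  rw [linearDiffOp, map_sum]
  refine Finset.sum_eq_zero fun m hm => ?_
  have hm' := Finset.mem_range.1 hm
  rw [Derivation.map_smul, derivation_iterate_deriv_eq_zero hD hx m (by omega), smul_zero]

theorem derivation_linearDiffOp (hD : ∀ k y, D (k + 1) y′ = (D (k + 1) y)′ + D k y)
    (hx : ∀ k, N < k → D k x = 0) (c : ℕ → F) (M : ℕ) :
    D (N + M) (linearDiffOp c M x) = c M • D N x := by
  rw [linearDiffOp, map_sum, Finset.sum_range_succ, Derivation.map_smul,
    derivation_iterate_deriv hD hx, Finset.sum_eq_zero, zero_add]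
  intro m hm
  have hm' := Finset.mem_range.1 hm
  rw [Derivation.map_smul, derivation_iterate_deriv_eq_zero hD hx m (by omega), smul_zero]

end LinearDiffOp

section FractionField

/-- The partial derivative `∂/∂x_i` of the field of fractions `K` of `F[x_i : i ∈ ι]`. -/
noncomputable def fracPDeriv (F : Type*) {ι : Type*} (K : Type*) [Field F] [Field K]
    [Algebra F K] [Algebra (MvPolynomial ι F) K] [IsScalarTower F (MvPolynomial ι F) K]
    [IsFractionRing (MvPolynomial ι F) K] (i : ι) : Derivation F K K :=
  haveI : Algebra.FormallyEtale (MvPolynomial ι F) K :=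
    .of_isLocalization (nonZeroDivisors (MvPolynomial ι F))
  extendDerivation K ((Algebra.linearMap (MvPolynomial ι F) K).compDer (pderiv i))

variable {F ι K : Type*} [Field F] [Field K] [Algebra F K] [Algebra (MvPolynomial ι F) K]
  [IsScalarTower F (MvPolynomial ι F) K] [IsFractionRing (MvPolynomial ι F) K]

theorem fracPDeriv_algebraMap (i : ι) (f : MvPolynomial ι F) :
    fracPDeriv F K i (algebraMap (MvPolynomial ι F) K f) = algebraMap _ K (pderiv i f) :=
  haveI : Algebra.FormallyEtale (MvPolynomial ι F) K :=
    .of_isLocalization (nonZeroDivisors (MvPolynomial ι F))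
  extendDerivation_algebraMap _ f

theorem fracPDeriv_div (i : ι) (f g : MvPolynomial ι F) :
    fracPDeriv F K i (algebraMap (MvPolynomial ι F) K f / algebraMap _ K g) =
      algebraMap _ K (g * pderiv i f - f * pderiv i g) / algebraMap _ K g ^ 2 := by
  rw [Derivation.leibniz_div, fracPDeriv_algebraMap, fracPDeriv_algebraMap, smul_eq_mul,
    smul_eq_mul, smul_eq_mul, map_sub, map_mul, map_mul, inv_pow, inv_mul_eq_div]

theorem finite_setOf_fracPDeriv_ne_zero (w : K) : {i : ι | fracPDeriv F K i w ≠ 0}.Finite := by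
  classical
  obtain ⟨f, g, -, rfl⟩ := IsFractionRing.div_surjective (A := MvPolynomial ι F) w
  refine (f.vars ∪ g.vars).finite_toSet.subset fun i hi => ?_
  contrapose! hi
  obtain ⟨hf, hg⟩ := not_or.1 (mt Finset.mem_union.2 hi)
  simp [fracPDeriv_div, pderiv_eq_zero_of_notMem_vars hf, pderiv_eq_zero_of_notMem_vars hg]

theorem mem_range_algebraMap_of_fracPDeriv_eq_zero [CharZero F] {w : K}
    (hw : ∀ i : ι, fracPDeriv F K i w = 0) : w ∈ Set.range (algebraMap F K) := by
  obtain ⟨f, g, hrel, rfl⟩ :=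
    IsFractionRing.exists_reduced_fraction (A := MvPolynomial ι F) w
  rw [IsFractionRing.mk'_eq_div] at hw ⊢
  have hg : algebraMap _ K (g : MvPolynomial ι F) ≠ 0 :=
    IsFractionRing.to_map_ne_zero_of_mem_nonZeroDivisors g.2
  have hwronskian (i : ι) : (g : MvPolynomial ι F) * pderiv i f = f * pderiv i g.1 := by
    have h := hw i
    rw [fracPDeriv_div, div_eq_zero_iff, or_iff_left (pow_ne_zero 2 hg)] at h
    exact sub_eq_zero.1 ((IsFractionRing.to_map_eq_zero_iff (K := K)).1 h)
  have hvars_g : g.1.vars = ∅ := Finset.eq_empty_of_forall_notMem fun i =>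
    pderiv_eq_zero_iff_notMem_vars.1 <| pderiv_eq_zero_of_dvd_pderiv <|
      hrel.symm.dvd_of_dvd_mul_left ⟨_, (hwronskian i).symm⟩
  have hvars_f : f.vars = ∅ := Finset.eq_empty_of_forall_notMem fun i =>
    pderiv_eq_zero_iff_notMem_vars.1 <| pderiv_eq_zero_of_dvd_pderiv <|
      hrel.dvd_of_dvd_mul_left ⟨_, hwronskian i⟩
  rw [vars_eq_empty_iff_eq_C] at hvars_f hvars_g
  refine ⟨coeff 0 f / coeff 0 g.1, ?_⟩
  rw [map_div₀, IsScalarTower.algebraMap_apply F (MvPolynomial ι F) K,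
    IsScalarTower.algebraMap_apply F (MvPolynomial ι F) K, algebraMap_eq, ← hvars_f, ← hvars_g]

theorem fracPDeriv_deriv_succ {F σ K : Type*} [Field F] [Differential F] [Field K]
    [Differential K] [Algebra F K] [Algebra (DiffPoly F σ) K] [IsScalarTower F (DiffPoly F σ) K]
    [IsFractionRing (DiffPoly F σ) K] [DifferentialAlgebra (DiffPoly F σ) K] (j : σ) (k : ℕ)
    (w : K) :
    fracPDeriv F K (j, k + 1) w′ = (fracPDeriv F K (j, k + 1) w)′ + fracPDeriv F K (j, k) w := by
  have hcomm : ⁅(fracPDeriv F K (j, k + 1)).restrictScalars ℤ,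
      (Differential.deriv : Derivation ℤ K K)⁆ = (fracPDeriv F K (j, k)).restrictScalars ℤ := by
    refine derivation_ext_of_isFractionRing (A := DiffPoly F σ) fun f => ?_
    simp only [Derivation.commutator_apply, Derivation.restrictScalars_apply, deriv_algebraMap,
      fracPDeriv_algebraMap, pderiv_deriv_succ, map_add, add_sub_cancel_left]
  rw [← sub_eq_iff_eq_add']
  exact DFunLike.congr_fun hcomm w

theorem mem_range_algebraMap_of_linearDiffOp_eq_zero {F K : Type*} (σ : Type*) [Field F]
    [CharZero F] [Differential F] [Field K] [Differential K] [Algebra F K]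
    [Algebra (DiffPoly F σ) K] [IsScalarTower F (DiffPoly F σ) K] [IsFractionRing (DiffPoly F σ) K]
    [DifferentialAlgebra (DiffPoly F σ) K] {c : ℕ → F} {M : ℕ}
    (hc : c M ≠ 0) {w : K} (hw : linearDiffOp c M w = 0) : w ∈ Set.range (algebraMap F K) := by
  refine mem_range_algebraMap_of_fracPDeriv_eq_zero (ι := σ × ℕ) fun ⟨j, n⟩ => ?_
  by_contra hn
  have hfin : {k : ℕ | fracPDeriv F K (j, k) w ≠ 0}.Finite :=
    (finite_setOf_fracPDeriv_ne_zero w).preimage (Prod.mk_right_injective j).injOn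
  obtain ⟨N, hN, hmax⟩ := Set.exists_max_image _ id hfin ⟨n, hn⟩
  have hzero (k : ℕ) (hk : N < k) : fracPDeriv F K (j, k) w = 0 :=
    not_not.1 fun hne => (hmax k hne).not_gt hk
  have htop := derivation_linearDiffOp (D := fun k => fracPDeriv F K (j, k))
    (fracPDeriv_deriv_succ j) hzero c M
  rw [hw, map_zero, eq_comm, smul_eq_zero] at htop
  exact htop.elim hc hN

end FractionField

section Evaluation

theorem diffEval_C {F E σ : Type*} [CommRing F] [CommRing E] [Differential E] [Algebra F E]
    (η : σ → E) (a : F) : diffEval η (C a : DiffPoly F σ) = algebraMap F E a :=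
  aeval_C _ _

theorem diffEval_X {F E σ : Type*} [CommRing F] [CommRing E] [Differential E] [Algebra F E]
    (η : σ → E) (v : σ × ℕ) :
    diffEval η (X v : DiffPoly F σ) = (Differential.deriv : Derivation ℤ E E)^[v.2] (η v.1) :=
  aeval_X _ _

theorem diffEval_deriv {F E σ : Type*} [CommRing F] [Differential F] [CommRing E] [Differential E]
    [Algebra F E] [DifferentialAlgebra F E] (η : σ → E) (f : DiffPoly F σ) :
    diffEval η f′ = (diffEval η f)′ := by
  induction f using MvPolynomial.induction_on with
  | C a => rw [deriv_C, diffEval_C, diffEval_C, deriv_algebraMap]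
  | add p q hp hq => simp only [map_add, hp, hq]
  | mul_X p v hp =>
    obtain ⟨j, k⟩ := v
    simp only [Derivation.leibniz, deriv_X, smul_eq_mul, map_add, map_mul, hp, diffEval_X,
      Function.iterate_succ_apply']

variable {F K E : Type*} [CommRing F] [CommRing K] [Differential K] [Algebra F K] [CommRing E]
  [Differential E] [Algebra F E] (φ : K →ₐ[F] E)

theorem map_iterate_deriv (hφ : ∀ a, φ a′ = (φ a)′) (k : ℕ) (a : K) :
    φ ((Differential.deriv : Derivation ℤ K K)^[k] a) =
      (Differential.deriv : Derivation ℤ E E)^[k] (φ a) :=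
  Function.Semiconj.iterate_right (f := φ) hφ k a

theorem map_linearDiffOp (hφ : ∀ a, φ a′ = (φ a)′) (c : ℕ → F) (M : ℕ) (a : K) :
    φ (linearDiffOp c M a) = linearDiffOp c M (φ a) := by
  simp only [linearDiffOp, map_sum, map_smul, map_iterate_deriv φ hφ]

theorem map_diffEval (hφ : ∀ a, φ a′ = (φ a)′) {σ : Type*} (η : σ → K) (f : DiffPoly F σ) :
    φ (diffEval η f) = diffEval (fun i => φ (η i)) f := by
  simp only [diffEval, comp_aeval_apply, map_iterate_deriv φ hφ]

end Evaluation

section DiffAdjoin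

/-- `s` is differentially algebraically independent over `F`: the derivatives of all orders of its
elements are algebraically independent. For `s = {u}` this says that `u` is differentially
transcendental. -/
def DiffAlgebraicIndependent (F : Type*) {E : Type*} [Field F] [Field E] [Differential E]
    [Algebra F E] (s : Set E) : Prop :=
  AlgebraicIndependent F fun v : s × ℕ => (Differential.deriv : Derivation ℤ E E)^[v.2] (v.1 : E)

theorem derivSet_eq_range {E : Type*} [CommRing E] [Differential E] (s : Set E) :
    derivSet s =
      Set.range fun v : s × ℕ => (Differential.deriv : Derivation ℤ E E)^[v.2] (v.1 : E) := by
  ext b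
  simp [derivSet, eq_comm]

theorem subset_diffAdjoin (F : Type*) {E : Type*} [Field F] [Field E] [Differential E]
    [Algebra F E] (s : Set E) : s ⊆ diffAdjoin F s :=
  fun a ha => IntermediateField.subset_adjoin _ _ ⟨a, ha, 0, rfl⟩

theorem mem_diffAdjoin_iff {F E : Type*} [Field F] [Field E] [Differential E] [Algebra F E]
    {s : Set E} {w : E} : w ∈ diffAdjoin F s ↔ ∃ P Q : DiffPoly F s,
      w = diffEval ((↑) : s → E) P / diffEval ((↑) : s → E) Q := by
  rw [diffAdjoin, derivSet_eq_range]
  exact IntermediateField.mem_adjoin_range_iff F _ w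

variable {F E : Type*} [Field F] [Differential F] [Field E] [Differential E] [Algebra F E]
  [DifferentialAlgebra F E] {s : Set E}

instance : DifferentialAlgebra F (diffAdjoin F s) :=
  ⟨fun a => Subtype.ext (deriv_algebraMap a)⟩

theorem diffEval_mem_diffAdjoin {σ : Type*} {η : σ → E} (hη : ∀ i, η i ∈ diffAdjoin F s)
    (f : DiffPoly F σ) : diffEval η f ∈ diffAdjoin F s :=
  map_diffEval (diffAdjoin F s).val (fun _ => rfl) (fun i => ⟨η i, hη i⟩) f ▸ Subtype.prop _

theorem mem_range_algebraMap_of_mem_diffAdjoin [CharZero F] (hs : DiffAlgebraicIndependent F s)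
    {c : ℕ → F} {M : ℕ} (hc : c M ≠ 0) {w : E} (hws : w ∈ diffAdjoin F s)
    (hw : linearDiffOp c M w = 0) : w ∈ Set.range (algebraMap F E) := by
  let ev : DiffPoly F s →ₐ[F] diffAdjoin F s :=
    diffEval fun a : s => ⟨a, subset_diffAdjoin F s a.2⟩
  have coe_ev (f : DiffPoly F s) : (ev f : E) = diffEval (↑) f :=
    map_diffEval (diffAdjoin F s).val (fun _ => rfl) _ f
  have hinj : Function.Injective ev := fun f g hfg =>
    hs ((coe_ev f).symm.trans ((congrArg Subtype.val hfg).trans (coe_ev g)))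
  let := ev.toAlgebra
  have : IsScalarTower F (DiffPoly F s) (diffAdjoin F s) :=
    .of_algebraMap_eq' ev.comp_algebraMap.symm
  have : DifferentialAlgebra (DiffPoly F s) (diffAdjoin F s) :=
    ⟨fun f => (diffEval_deriv _ f).symm⟩
  have : FaithfulSMul (DiffPoly F s) (diffAdjoin F s) :=
    (faithfulSMul_iff_algebraMap_injective _ _).2 hinj
  have : IsFractionRing (DiffPoly F s) (diffAdjoin F s) := .of_field _ _ fun z => by
    obtain ⟨P, Q, hz⟩ := mem_diffAdjoin_iff.1 z.2
    exact ⟨P, Q, Subtype.ext (by simp [hz, RingHom.algebraMap_toAlgebra, coe_ev])⟩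
  obtain ⟨a, ha⟩ := mem_range_algebraMap_of_linearDiffOp_eq_zero s hc
    (w := (⟨w, hws⟩ : diffAdjoin F s))
    (Subtype.ext ((map_linearDiffOp (diffAdjoin F s).val (fun _ => rfl) c M _).trans hw))
  exact ⟨a, congrArg Subtype.val ha⟩

end DiffAdjoin

section Order

variable {F σ : Type*} [CommRing F] [Fintype σ]

theorem ord_le_iff {f : DiffPoly F σ} {n : WithBot ℕ} : f.ord ≤ n ↔ ∀ v ∈ f.vars, v.2 ≤ n := by
  simp only [ord, ordAt, Finset.sup_le_iff, Finset.mem_univ, true_imp_iff, Finset.mem_filter]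
  exact ⟨fun h v hv => h v.1 v ⟨hv, rfl⟩, fun h _ v hv => h v hv.1⟩

theorem le_ord {f : DiffPoly F σ} {v : σ × ℕ} (hv : v ∈ f.vars) : (v.2 : WithBot ℕ) ≤ f.ord :=
  ord_le_iff.1 le_rfl v hv

theorem exists_mem_vars_ord_eq {f : DiffPoly F σ} (hf : f ∉ Set.range C) :
    ∃ v ∈ f.vars, f.ord = v.2 := by
  have hne : f.vars.Nonempty := Finset.nonempty_iff_ne_empty.2 fun h =>
    hf ⟨_, (vars_eq_empty_iff_eq_C.1 h).symm⟩
  obtain ⟨v, hv, hmax⟩ := Finset.exists_max_image f.vars Prod.snd hne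
  exact ⟨v, hv, (ord_le_iff.2 fun w hw => WithBot.coe_le_coe.2 (hmax w hw)).antisymm (le_ord hv)⟩

theorem ord_C (a : F) : ord (C a : DiffPoly F σ) = ⊥ :=
  eq_bot_iff.2 (ord_le_iff.2 (by simp))

theorem ord_sub_C (f : DiffPoly F σ) (a : F) : (f - C a).ord = f.ord := by
  classical simp [ord, ordAt, vars_sub_of_disjoint]

theorem ord_linearDiffOp [IsDomain F] [CharZero F] [Differential F] {c : ℕ → F} {M : ℕ}
    (hc : c M ≠ 0) {f : DiffPoly F σ} (hf : f ∉ Set.range C) :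
    (linearDiffOp c M f).ord = f.ord + M := by
  obtain ⟨⟨j, N⟩, hv, hord⟩ := exists_mem_vars_ord_eq hf
  have hzero (i : σ) (k : ℕ) (hk : N < k) : pderiv (i, k) f = 0 :=
    pderiv_eq_zero_of_notMem_vars fun h =>
      (WithBot.coe_le_coe.1 ((le_ord h).trans_eq hord)).not_gt hk
  rw [hord]
  refine le_antisymm (ord_le_iff.2 fun ⟨i, k⟩ hk => ?_) ?_
  · contrapose! hk
    rw [← pderiv_eq_zero_iff_notMem_vars]
    exact derivation_linearDiffOp_eq_zero (D := fun k => pderiv (i, k)) (pderiv_deriv_succ i)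
      (hzero i) c M (by exact_mod_cast hk)
  · have htop := derivation_linearDiffOp (D := fun k => pderiv (j, k)) (pderiv_deriv_succ j)
      (hzero j) c M
    refine le_ord (v := (j, N + M)) (not_not.1 fun h => ?_)
    rw [pderiv_eq_zero_of_notMem_vars h, eq_comm, smul_eq_zero] at htop
    exact htop.elim hc (mt pderiv_eq_zero_iff_notMem_vars.1 (not_not.2 hv))

end Order

section DiffSpan

theorem isDiffIdeal_diffSpan {R : Type*} [CommRing R] [Differential R] (S : Set R) :
    IsDiffIdeal (diffSpan S) := by
  intro f hf
  rw [diffSpan, Submodule.mem_sInf] at hf ⊢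
  exact fun I hI => hI.1 f (hf I hI)

theorem subset_diffSpan {R : Type*} [CommRing R] [Differential R] (S : Set R) :
    S ⊆ diffSpan S := by
  intro f hf
  rw [SetLike.mem_coe, diffSpan, Submodule.mem_sInf]
  exact fun I hI => hI.2 hf

theorem diffSpan_le {R : Type*} [CommRing R] [Differential R] {S : Set R} {I : Ideal R}
    (hI : IsDiffIdeal I) (hS : S ⊆ I) : diffSpan S ≤ I :=
  sInf_le ⟨hI, hS⟩

theorem diffSpan_le_span_derivSet {R : Type*} [CommRing R] [Differential R] (S : Set R) :
    diffSpan S ≤ Ideal.span (derivSet S) := by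
  refine diffSpan_le (fun g hg => ?_) fun f hf => Ideal.subset_span ⟨f, hf, 0, rfl⟩
  induction hg using Submodule.span_induction with
  | mem x hx =>
    obtain ⟨f, hf, k, rfl⟩ := hx
    exact Ideal.subset_span ⟨f, hf, k + 1, (Function.iterate_succ_apply' _ _ _).symm⟩
  | zero => rw [map_zero]; exact zero_mem _
  | add x y _ _ hx hy => rw [map_add]; exact add_mem hx hy
  | smul a x hx hx' =>
    rw [smul_eq_mul, Derivation.leibniz, smul_eq_mul, smul_eq_mul, mul_comm x]
    exact add_mem (Ideal.mul_mem_left _ _ hx') (Ideal.mul_mem_left _ _ hx)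

theorem exists_linearDiffOp_of_mem_span_derivSet {F K : Type*} [CommRing F] [CommRing K]
    [Differential K] [Algebra F K] {x y : K} (hy : y ∈ Submodule.span F (derivSet {x}))
    (hy₀ : y ≠ 0) : ∃ (c : ℕ → F) (M : ℕ), c M ≠ 0 ∧ y = linearDiffOp c M x := by
  have hrange : derivSet {x} =
      Set.range fun k : ℕ => (Differential.deriv : Derivation ℤ K K)^[k] x := by
    ext b
    simp [derivSet, eq_comm]
  rw [hrange] at hy
  obtain ⟨c, rfl⟩ := Finsupp.mem_span_range_iff_exists_finsupp.1 hy
  have hc : c.support.Nonempty :=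
    Finsupp.support_nonempty_iff.2 fun h => hy₀ (by rw [h, Finsupp.sum_zero_index])
  refine ⟨c, c.support.max' hc, Finsupp.mem_support_iff.1 (Finset.max'_mem _ _), ?_⟩
  refine Finsupp.sum_of_support_subset c (fun k hk => ?_) _ fun k _ => zero_smul _ _
  exact Finset.mem_range.2 (Nat.lt_succ_of_le (Finset.le_max' _ _ hk))

end DiffSpan

section Linear

theorem degree_le_one_iff {ι : Type*} {s : ι →₀ ℕ} :
    s.degree ≤ 1 ↔ s = 0 ∨ ∃ i, s = Finsupp.single i 1 := by
  rw [Nat.le_one_iff_eq_zero_or_eq_one, Finsupp.degree_eq_zero_iff]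
  exact or_congr Iff.rfl (Finsupp.sum_eq_one_iff s)

theorem restrictTotalDegree_one_eq_span (ι R : Type*) [CommSemiring R] :
    restrictTotalDegree ι R 1 = Submodule.span R (insert 1 (Set.range X)) := by
  refine le_antisymm (fun f hf => ?_) (Submodule.span_le.2 ?_)
  · rw [f.as_sum]
    refine Submodule.sum_mem _ fun s hs => ?_
    rw [← mul_one (coeff s f), ← smul_eq_mul, ← smul_monomial]
    refine Submodule.smul_mem _ _ (Submodule.subset_span ?_)
    rw [mem_restrictTotalDegree] at hf
    obtain rfl | ⟨i, rfl⟩ := degree_le_one_iff.1 ((le_totalDegree hs).trans hf)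
    · exact .inl rfl
    · exact .inr ⟨i, rfl⟩
  · rintro _ (rfl | ⟨i, rfl⟩)
    · simp [mem_restrictTotalDegree]
    · rw [SetLike.mem_coe, mem_restrictTotalDegree]
      exact (totalDegree_monomial_le _ _).trans (by simp)

theorem mem_of_mem_ideal_span {F ι : Type*} [Field F] {V : Submodule F (MvPolynomial ι F)}
    (hV : V ≤ restrictTotalDegree ι F 1) (hV₁ : 1 ∉ V) {f : MvPolynomial ι F}
    (hf : f ∈ restrictTotalDegree ι F 1) (hfV : f ∈ Ideal.span (V : Set (MvPolynomial ι F))) :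
    f ∈ V := by
  obtain ⟨W, hW, hcompl⟩ := (Submodule.disjoint_span_singleton_of_notMem hV₁).symm.exists_isCompl
  rw [Submodule.span_singleton_le_iff_mem] at hW
  -- The projection `π` with kernel `V` fixes `1`, so in degree at most one it agrees with the ring
  -- homomorphism sending each variable to its projection.
  let π := W.projection V hcompl
  have hker (g : MvPolynomial ι F) : π g = 0 ↔ g ∈ V := by
    rw [← LinearMap.mem_ker, Submodule.ker_projection]
  have haeval : ∀ g ∈ restrictTotalDegree ι F 1, aeval (fun i => π (X i)) g = π g := by
    intro g hg
    rw [restrictTotalDegree_one_eq_span] at hg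
    refine LinearMap.eqOn_span (f := (aeval fun i => π (X i)).toLinearMap) ?_ hg
    rintro _ (rfl | ⟨i, rfl⟩)
    · simpa using (Submodule.projection_apply_left hcompl ⟨1, hW⟩).symm
    · simp
  have hle : Ideal.span V ≤ RingHom.ker (aeval fun i => π (X i)) :=
    Ideal.span_le.2 fun g hg => (haeval g (hV hg)).trans ((hker g).2 hg)
  exact (hker f).1 ((haeval f hf).symm.trans (hle hfV))

theorem IsLinear.deriv {R σ : Type*} [CommRing R] [Differential R] {f : DiffPoly R σ}
    (hf : f.IsLinear) : IsLinear f′ := by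
  simp only [IsLinear, ← mem_restrictTotalDegree] at hf ⊢
  rw [restrictTotalDegree_one_eq_span] at hf ⊢
  induction hf using Submodule.span_induction with
  | mem x hx =>
    obtain rfl | ⟨⟨j, k⟩, rfl⟩ := hx
    · simp
    · rw [deriv_X]
      exact Submodule.subset_span (.inr ⟨_, rfl⟩)
  | zero => simp
  | add x y _ _ hx hy => rw [map_add]; exact add_mem hx hy
  | smul a x hx hx' =>
    rw [smul_eq_C_mul, Derivation.leibniz, deriv_C, smul_eq_mul, smul_eq_mul, mul_comm x,
      ← smul_eq_C_mul, ← smul_eq_C_mul]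
    exact add_mem (Submodule.smul_mem _ _ hx') (Submodule.smul_mem _ _ hx)

theorem IsLinear.iterate_deriv {R σ : Type*} [CommRing R] [Differential R] {f : DiffPoly R σ}
    (hf : f.IsLinear) (k : ℕ) :
    IsLinear ((Differential.deriv : Derivation ℤ (DiffPoly R σ) (DiffPoly R σ))^[k] f) :=
  Function.Iterate.rec (fun g => IsLinear g) hf (fun _ h => IsLinear.deriv h) k

theorem IsLinear.sub_C {R σ : Type*} [CommRing R] {f : DiffPoly R σ} (hf : f.IsLinear) (a : R) :
    (f - C a).IsLinear :=
  (totalDegree_sub_C_le f a).trans hf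

theorem IsLinear.exists_linearDiffOp_of_mem_diffSpan {F σ : Type*} [Field F] [CharZero F]
    [Differential F] [Finite σ] {B f : DiffPoly F σ} (hB : B.IsLinear) (hB' : B ∉ Set.range C)
    (hf : f.IsLinear) (hf₀ : f ≠ 0) (h : f ∈ diffSpan {B}) :
    ∃ (c : ℕ → F) (M : ℕ), c M ≠ 0 ∧ f = linearDiffOp c M B := by
  cases nonempty_fintype σ
  refine exists_linearDiffOp_of_mem_span_derivSet (mem_of_mem_ideal_span ?_ ?_
    ((mem_restrictTotalDegree _ _ _).2 hf) ?_) hf₀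
  · rw [Submodule.span_le]
    rintro _ ⟨_, rfl, k, rfl⟩
    exact (mem_restrictTotalDegree _ _ _).2 (hB.iterate_deriv k)
  · intro h₁
    obtain ⟨c, M, hc, heq⟩ := exists_linearDiffOp_of_mem_span_derivSet h₁ one_ne_zero
    obtain ⟨v, -, hv⟩ := exists_mem_vars_ord_eq hB'
    have hord := ord_linearDiffOp hc hB'
    rw [← heq, ← C_1, ord_C, hv] at hord
    exact WithBot.bot_ne_coe hord
  · exact Ideal.span_mono Submodule.subset_span (diffSpan_le_span_derivSet _ h)

theorem IsLinear.separant_eq_C {R σ : Type*} [CommRing R] {A : DiffPoly R σ} (hA : A.IsLinear)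
    (v : σ × ℕ) : separant A v = C (coeff (Finsupp.single v 1) A) := by
  classical
  have hspan : A ∈ Submodule.span R (insert 1 (Set.range X)) := by
    rwa [← restrictTotalDegree_one_eq_span, mem_restrictTotalDegree]
  refine LinearMap.eqOn_span (f := (pderiv v).toLinearMap)
    (g := Algebra.linearMap R (DiffPoly R σ) ∘ₗ lcoeff R (Finsupp.single v 1)) ?_ hspan
  rintro _ (rfl | ⟨w, rfl⟩)
  · simp [coeff_one, eq_comm (a := (0 : σ × ℕ →₀ ℕ))]
  · simp [pderiv_X, coeff_X, Pi.single_apply, Finsupp.single_left_inj, apply_ite C]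

theorem IsLinear.initial_eq_C {R σ : Type*} [CommRing R] {A : DiffPoly R σ} (hA : A.IsLinear)
    {v : σ × ℕ} (hv : v ∈ A.vars) : initial A v = C (coeff (Finsupp.single v 1) A) := by
  classical
  have hdeg : A.degreeOf v = 1 := ((degreeOf_le_totalDegree A v).trans hA).antisymm
    (Nat.one_le_iff_ne_zero.2 (mem_vars_iff_degreeOf_ne_zero.1 hv))
  have hsupport (s : σ × ℕ →₀ ℕ) (hs : s ∈ A.support) (hsv : s v = 1) :
      s = Finsupp.single v 1 := by
    obtain rfl | ⟨w, rfl⟩ := degree_le_one_iff.1 ((le_totalDegree hs).trans hA)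
    · simp at hsv
    · rw [(Finsupp.single_apply_ne_zero.1 (hsv.trans_ne one_ne_zero)).1]
  rw [initial, hdeg, Finset.sum_filter]
  refine (Finset.sum_eq_single (Finsupp.single v 1) (fun s hs hne => ?_) fun hs => ?_).trans ?_
  · rw [if_neg (mt (hsupport s hs) hne)]
  · simp [notMem_support_iff.1 hs]
  · simp

theorem IsLinear.mem_diffSpan_of_mem_sat {F σ : Type*} [Field F] [CharZero F] [Differential F]
    {R : Ranking σ} {A f : DiffPoly F σ} (hA : A.IsLinear) (hf : f ∈ sat R A) :
    f ∈ diffSpan {A} := by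
  obtain ⟨v, ⟨hv, -⟩, m, hm⟩ := hf
  have hcoeff : IsUnit (coeff (Finsupp.single v 1) A) := isUnit_iff_ne_zero.2 fun h =>
    pderiv_eq_zero_iff_notMem_vars.1 ((hA.separant_eq_C v).trans (by rw [h, C_0])) hv
  rw [hA.separant_eq_C, hA.initial_eq_C hv, ← C_mul, ← C_pow] at hm
  exact (Ideal.unit_mul_mem_iff_mem _ (((hcoeff.mul hcoeff).pow m).map C)).1 hm

theorem IsLinear.ord_eq_and_diffSpan_eq {F σ : Type*} [Field F] [CharZero F] [Differential F]
    [Fintype σ] {A B : DiffPoly F σ} (hA : A.IsLinear) (hA' : A ∉ Set.range C)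
    (hB : B.IsLinear) (hB' : B ∉ Set.range C) (hAB : A ∈ diffSpan {B}) {b : F}
    (hBA : B - C b ∈ diffSpan {A}) : A.ord = B.ord ∧ diffSpan {A} = diffSpan {B} := by
  have hA₀ : A ≠ 0 := fun h => hA' ⟨0, by rw [h, C_0]⟩
  have hB₀ : B - C b ≠ 0 := fun h => hB' ⟨b, (sub_eq_zero.1 h).symm⟩
  obtain ⟨c, M, hc, hAop⟩ := hB.exists_linearDiffOp_of_mem_diffSpan hB' hA hA₀ hAB
  obtain ⟨c', M', hc', hBop⟩ :=
    hA.exists_linearDiffOp_of_mem_diffSpan hA' (hB.sub_C b) hB₀ hBA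
  have hordA : A.ord = B.ord + M := by rw [hAop, ord_linearDiffOp hc hB']
  have hordB : B.ord = A.ord + M' := by rw [← ord_sub_C B b, hBop, ord_linearDiffOp hc' hA']
  obtain rfl : M = 0 := by
    obtain ⟨v, -, hv⟩ := exists_mem_vars_ord_eq hB'
    rw [hordA, hv] at hordB
    norm_cast at hordB
    omega
  have hsmul : A = c 0 • B := by simpa [linearDiffOp] using hAop
  refine ⟨by simpa using hordA,
    (diffSpan_le (isDiffIdeal_diffSpan _) (Set.singleton_subset_iff.2 hAB)).antisymm
      (diffSpan_le (isDiffIdeal_diffSpan _) (Set.singleton_subset_iff.2 ?_))⟩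
  rw [SetLike.mem_coe, ← Ideal.unit_mul_mem_iff_mem _ ((isUnit_iff_ne_zero.2 hc).map C),
    ← smul_eq_C_mul, ← hsmul]
  exact subset_diffSpan _ rfl

end Linear

section Unirational

/-- The set `P` of differential polynomials has a generic point whose coordinates lie in a purely
differentially transcendental extension `F⟨s⟩ ⊆ E` of `F`. For `P = sat(A)` this is unirationality
of the differential hypersurface `𝕍(sat(A))`, with any number of parameters allowed. -/
def IsDiffUnirational {F σ : Type*} (E : Type*) [Field F] [Field E] [Differential E] [Algebra F E]
    (P : Set (DiffPoly F σ)) : Prop :=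
  ∃ (s : Set E) (η : σ → E), DiffAlgebraicIndependent F s ∧ (∀ i, η i ∈ diffAdjoin F s) ∧
    IsDiffGenericPoint η P

theorem _root_.IsUnirational.isDiffUnirational_sat {F E : Type*} [Field F] [Differential F]
    [Field E] [Differential E] [Algebra F E] [DifferentialAlgebra F E] {R : Ranking (Fin 2)}
    {A : DiffPoly F (Fin 2)} (h : IsUnirational E R A) : IsDiffUnirational E (sat R A) := by
  obtain ⟨u, P, Q, hu, -, hη⟩ := h
  have hmem (f : DiffPoly F Unit) : diffEval (fun _ => u) f ∈ diffAdjoin F {u} :=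
    diffEval_mem_diffAdjoin (fun _ => subset_diffAdjoin F {u} (Set.mem_singleton u)) f
  refine ⟨{u}, _, ?_, fun i => div_mem (hmem (P i)) (hmem (Q i)), hη⟩
  have hsnd : Function.Injective (Prod.snd : ({u} : Set E) × ℕ → ℕ) :=
    fun v w h => Prod.ext (Subsingleton.elim _ _) h
  have heq (v : ({u} : Set E) × ℕ) : (Differential.deriv : Derivation ℤ E E)^[v.2] u =
      (Differential.deriv : Derivation ℤ E E)^[v.2] v.1 := by
    rw [Set.mem_singleton_iff.1 v.1.2]
  rw [DiffAlgebraicIndependent, ← funext heq]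
  exact AlgebraicIndependent.comp hu _ hsnd

theorem IsLinear.exists_sub_C_mem_diffSpan {F E σ : Type*} [Field F] [CharZero F] [Differential F]
    [Field E] [Differential E] [Algebra F E] [DifferentialAlgebra F E] {R : Ranking σ}
    {A B : DiffPoly F σ} (hA : A.IsLinear) {c : ℕ → F} {M : ℕ} (hc : c M ≠ 0)
    (hAB : A = linearDiffOp c M B) (h : IsDiffUnirational E (sat R A)) :
    ∃ b, B - C b ∈ diffSpan {A} := by
  obtain ⟨s, η, hs, hηs, hη⟩ := h
  have mem_sat_iff (f : DiffPoly F σ) : f ∈ sat R A ↔ diffEval η f = 0 := by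
    rw [← hη, Set.mem_ofPred_eq]
  -- `A ∈ sat(A)` needs a leader of `A`; the one witnessing `0 ∈ sat(A)` does.
  obtain ⟨v, hv, -⟩ := (mem_sat_iff 0).2 (map_zero _)
  have hAη : diffEval η A = 0 := (mem_sat_iff A).1
    ⟨v, hv, 0, Ideal.mul_mem_left _ _ (subset_diffSpan _ rfl)⟩
  rw [hAB, map_linearDiffOp _ (diffEval_deriv η)] at hAη
  obtain ⟨b, hb⟩ :=
    mem_range_algebraMap_of_mem_diffAdjoin hs hc (diffEval_mem_diffAdjoin hηs B) hAη
  refine ⟨b, hA.mem_diffSpan_of_mem_sat ((mem_sat_iff _).2 ?_)⟩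
  rw [map_sub, diffEval_C, hb, sub_self]

end Unirational

end DiffPoly

open DiffPoly in
theorem mainTheorem10_general {F E σ : Type*} [Field F] [CharZero F] [Differential F] [Field E]
    [Differential E] [Algebra F E] [DifferentialAlgebra F E] [Fintype σ] (R : Ranking σ)
    (A B : DiffPoly F σ) (hA : A.IsLinear) (hA' : A ∉ Set.range MvPolynomial.C)
    (hB : B.IsLinear) (hB' : B ∉ Set.range MvPolynomial.C) :
    (A ∈ diffSpan {B} → B.ord < A.ord → ¬ IsDiffUnirational E (sat R A)) ∧
    (IsDiffUnirational E (sat R A) → diffSpan {A} ≤ diffSpan {B} →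
      diffSpan {A} = diffSpan {B}) := by
  have hA₀ : A ≠ 0 := fun h => hA' ⟨0, by rw [h, MvPolynomial.C_0]⟩
  have key (hAB : A ∈ diffSpan {B}) (hun : IsDiffUnirational E (sat R A)) :
      A.ord = B.ord ∧ diffSpan {A} = diffSpan {B} := by
    obtain ⟨c, M, hc, hAop⟩ := hB.exists_linearDiffOp_of_mem_diffSpan hB' hA hA₀ hAB
    obtain ⟨b, hb⟩ := hA.exists_sub_C_mem_diffSpan hc hAop hun
    exact hA.ord_eq_and_diffSpan_eq hA' hB hB' hAB hb
  exact ⟨fun hAB hlt hun => hlt.ne' (key hAB hun).1,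
    fun hun hle => (key (hle (subset_diffSpan _ rfl)) hun).2⟩

theorem mainTheorem10 {F : Type*} {E : Type*} [Field F] [CharZero F] [Differential F] [Field E]
    [Differential E] [Algebra F E] [DifferentialAlgebra F E] (hE : IsUniversalDiffExt F E)
    (R : Ranking (Fin 2)) (A B : DiffPoly F (Fin 2))
    (hA : A.IsLinear) (hA' : A ∉ Set.range MvPolynomial.C)
    (hB : B.IsLinear) (hB' : B ∉ Set.range MvPolynomial.C) :
    (A ∈ diffSpan {B} → B.ord < A.ord → ¬ IsUnirational E R A) ∧
    (IsUnirational E R A → diffSpan {A} ≤ diffSpan {B} → diffSpan {A} = diffSpan {B}) :=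
  have hgeneral := mainTheorem10_general (E := E) R A B hA hA' hB hB'
  ⟨fun hAB hlt h => hgeneral.1 hAB hlt h.isDiffUnirational_sat,
    fun h => hgeneral.2 h.isDiffUnirational_sat⟩
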